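/- Consider a loss system with $K$ customer classes and two layers of servers: layer 1 has $m_k\ge 0$ servers dedicated to class $k$ ($k=1,\dots,K$), and layer 2 has $n\ge 0$ servers that can serve every class. Class-$k$ customers arrive according to a Poisson process of rate $\lambda_k>0$ and have exponential service times of parameter $\mu_k>0$, all independent. An arriving class-$k$ customer goes to a free class-$k$ server of layer 1 if there is one, otherwise to a free server of layer 2, and is rejected if there is none. Thus the numbers $X_{i,k}$ of class-$k$ customers in service at layer $i$ form a continuous-time Markov process on $$S=\Big\{x\in\mathbb Z_+^K\times\mathbb Z_+^K:\ x_{1,k}\le m_k\ \text{for all }k,\ \sum_{k}x_{2,k}\le n\Big\}$$ with transitions $x\mapsto x+e_{i,k}$ at rate $\lambda_k 1(x\in A_{i,k})$ and $x\mapsto x-e_{i,k}$ at rate $\mu_k x_{i,k}$, where $e_{i,k}$ are the unit vectors, $A_{1,k}=\{x\in S:x_{1,k}<m_k\}$ and $A_{2,k}=\{x\in S:x_{1,k}=m_k,\ \sum_l x_{2,l}<n\}$. This process has a unique stationary distribution. Let $\bar X=(\bar X_{i,k})$ be a random vector with that distribution. For each class $k$ let $a_k=\operatorname{E}(\bar X_{1,k}+\bar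 X_{2,k})$ be the stationary mean number of class-$k$ customers; let $\theta_k=\operatorname{E}\big(\sum_{i=1,2}\mu_k\bar X_{i,k}\big)$ be the stationary mean class-$k$ throughput, that is, the mean rate at which class-$k$ customers complete service; and let $b_k=\operatorname{P}\big(\bar X_{1,k}=m_k,\ \sum_l\bar X_{2,l}=n\big)$ be the class-$k$ blocking probability, that is, the stationary probability of the states in which arriving class-$k$ customers are rejected. For $s\in\mathbb Z_+$ and $\rho>0$ let $\operatorname{Erl}(s,\rho)$ be a random variable on $\{0,\dots,s\}$ with $\operatorname{P}(\operatorname{Erl}(s,\rho)=i)=\big(\sum_{j=0}^s\rho^j/j!\big)^{-1}\rho^i/i!$, let $a_{\rm Erl}(s,\rho)$ be its mean, and let $b_{\rm Erl}(s,\rho)=\operatorname{P}(\operatorname{Erl}(s,\rho)=s)$ (the Erlang B formula). Write $U\le_{\rm st}V$ if $\operatorname{E}f(U)\le\operatorname{E}f(V)$ for all bounded measurable increasing $f:\mathbb R\to\mathbb R$. Then for every class $k$, $$\operatorname{Erl}(m_k,\lambda_k/\mu_k)\le_{\rm st}\bar X_{1,k}+\bar X_{2,k}\le_{\rm st}\operatorname{Erl}(m_k+n,\lambda_k/\mu_k),$$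 $$a_{\rm Erl}(m_k,\lambda_k/\mu_k)\le a_k\le a_{\rm Erl}(m_k+n,\lambda_k/\mu_k),$$ $$\mu_k\,a_{\rm Erl}(m_k,\lambda_k/\mu_k)\le\theta_k\le\mu_k\,a_{\rm Erl}(m_k+n,\lambda_k/\mu_k),$$ $$b_{\rm Erl}(m_k+n,\lambda_k/\mu_k)\le b_k\le b_{\rm Erl}(m_k,\lambda_k/\mu_k).$$ -/

import Mathlib

open MeasureTheory

namespace TwoLayerLoss

noncomputable section

/-! ### Continuous-time Markov chains on a finite state space -/

section Markov

variable {S : Type*} [Fintype S] [DecidableEq S]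

/-- The generator (`Q`-matrix) of the Markov jump process with jumps `x ↦ y`, `y ≠ x`, at rate
`r x y`. -/
def generatorOfRates (r : S → S → ℝ) : Matrix S S ℝ :=
  fun x y => if x = y then -∑ z ∈ Finset.univ.erase x, r x z else r x y

/-- The transition function `P_t = exp (t Q)` of the Markov process with generator `Q`:
`transition Q t x y` is the probability of being in `y` at time `t` when started in `x`. -/
def transition (Q : Matrix S S ℝ) (t : ℝ) : Matrix S S ℝ :=
  NormedSpace.exp (t • Q)

/-- `π` is a stationary distribution of the Markov process with generator `Q`: a probability
measure such that the process started from `π` has law `π` at all times `t ≥ 0`. -/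
structure IsStationaryDist [MeasurableSpace S] (Q : Matrix S S ℝ) (π : Measure S) : Prop where
  isProbabilityMeasure : IsProbabilityMeasure π
  invariant : ∀ t : ℝ, 0 ≤ t → ∀ y : S, ∑ x, π.real {x} * transition Q t x y = π.real {y}

end Markov

/-! ### The two-layer loss system with overflow routing -/

section Model

variable {K : ℕ}

/-- The state space. `x i k` is the number of class-`k` customers in service at a layer; the index
`i = 0` is the first layer (dedicated servers), `i = 1` the second layer (shared servers). -/
def State (m : Fin K → ℕ) (n : ℕ) : Type :=
  {x : Fin 2 → Fin K → ℕ // (∀ k, x 0 k ≤ m k) ∧ ∑ k, x 1 k ≤ n}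

variable {m : Fin K → ℕ} {n : ℕ}

instance : DecidableEq (State m n) :=
  inferInstanceAs (DecidableEq {x : Fin 2 → Fin K → ℕ // (∀ k, x 0 k ≤ m k) ∧ ∑ k, x 1 k ≤ n})

instance : Finite (State m n) := by
  have h : Set.Finite {x : Fin 2 → Fin K → ℕ | (∀ k, x 0 k ≤ m k) ∧ ∑ k, x 1 k ≤ n} := by
    refine (Set.finite_Iic (![m, fun _ => n] : Fin 2 → Fin K → ℕ)).subset ?_
    rintro x ⟨h0, h1⟩
    rw [Set.mem_Iic]
    intro i k
    fin_cases i
    · exact h0 k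
    · exact (Finset.single_le_sum (f := x 1) (fun _ _ => Nat.zero_le _)
        (Finset.mem_univ k)).trans h1
  exact h.to_subtype

instance : Fintype (State m n) := Fintype.ofFinite _

instance : MeasurableSpace (State m n) := ⊤

/-- The unit vector in the coordinate direction `(i, k)`. -/
def unitVec (i : Fin 2) (k : Fin K) : Fin 2 → Fin K → ℕ :=
  Pi.single i (Pi.single k 1)

/-- The set `A_{i,k}` of states in which an arriving class-`k` customer is assigned to a server of
layer `i`. -/
def acceptSet (m : Fin K → ℕ) (n : ℕ) : Fin 2 → Fin K → Set (State m n)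
  | 0, k => {x | x.1 0 k < m k}
  | 1, k => {x | x.1 0 k = m k ∧ ∑ l, x.1 1 l < n}

/-- The set `B_k` of states in which an arriving class-`k` customer is rejected. -/
def blockSet (m : Fin K → ℕ) (n : ℕ) (k : Fin K) : Set (State m n) :=
  {x | x.1 0 k = m k ∧ ∑ l, x.1 1 l = n}

/-- The rate of the transition `x ↦ x + e_{i,k}`. -/
def upRate (lam : Fin K → ℝ) (i : Fin 2) (k : Fin K) (x : State m n) : ℝ :=
  (acceptSet m n i k).indicator (fun _ => lam k) x

/-- The rate of the transition `x ↦ x - e_{i,k}`, that is, of class-`k` service completions at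
layer `i`. -/
def downRate (mu : Fin K → ℝ) (i : Fin 2) (k : Fin K) (x : State m n) : ℝ :=
  mu k * (x.1 i k : ℝ)

/-- The jump rate from `x` to `y`. -/
def jumpRate (lam mu : Fin K → ℝ) (x y : State m n) : ℝ :=
  ∑ i, ∑ k, ((if y.1 = x.1 + unitVec i k then upRate lam i k x else 0) +
    (if x.1 = y.1 + unitVec i k then downRate mu i k x else 0))

/-- The generator of the process `X = (X_{i,k})`. -/
def generator (m : Fin K → ℕ) (n : ℕ) (lam mu : Fin K → ℝ) :
    Matrix (State m n) (State m n) ℝ :=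
  generatorOfRates (jumpRate lam mu)

/-- The number `x_{1,k} + x_{2,k}` of class-`k` customers in the system, as a real number. -/
def classCount (k : Fin K) (x : State m n) : ℝ :=
  (x.1 0 k : ℝ) + (x.1 1 k : ℝ)

/-- The mean number `a_k` of class-`k` customers under the distribution `π`. -/
def meanNumber (π : Measure (State m n)) (k : Fin K) : ℝ :=
  ∫ x, classCount k x ∂π

/-- The mean class-`k` throughput `θ_k` under the distribution `π`: the mean rate at which class-`k`
customers complete service at the two layers. -/
def throughput (mu : Fin K → ℝ) (π : Measure (State m n)) (k : Fin K) : ℝ :=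
  ∫ x, ∑ i, downRate mu i k x ∂π

/-- The class-`k` blocking probability `b_k` under the distribution `π`: the probability that the
system is in a state in which arriving class-`k` customers are rejected. -/
def blockingProb (π : Measure (State m n)) (k : Fin K) : ℝ :=
  π.real (blockSet m n k)

end Model

/-! ### The Erlang distribution and the stochastic order -/

/-- The probability of `i ∈ {0, …, s}` under `Erl(s, ρ)`. -/
def erlWeight (s : ℕ) (ρ : ℝ) (i : ℕ) : ℝ :=
  (∑ j ∈ Finset.range (s + 1), ρ ^ j / (j.factorial : ℝ))⁻¹ * (ρ ^ i / (i.factorial : ℝ))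

/-- The law `Erl(s, ρ)` (Poisson distribution truncated to `{0, …, s}`), as a law on `ℝ`. -/
def erl (s : ℕ) (ρ : ℝ) : Measure ℝ :=
  ∑ i ∈ Finset.range (s + 1), ENNReal.ofReal (erlWeight s ρ i) • Measure.dirac (i : ℝ)

/-- The mean `a_Erl(s, ρ)`. -/
def erlMean (s : ℕ) (ρ : ℝ) : ℝ :=
  ∫ x, x ∂(erl s ρ)

/-- The probability `b_Erl(s, ρ)` of being equal to `s` (the Erlang B formula). -/
def erlBlocking (s : ℕ) (ρ : ℝ) : ℝ :=
  (erl s ρ).real {(s : ℝ)}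

/-- The usual stochastic order between laws of real random variables. -/
def StLE (ν ξ : Measure ℝ) : Prop :=
  ∀ f : ℝ → ℝ, Monotone f → Measurable f → (∃ C : ℝ, ∀ x, |f x| ≤ C) →
    ∫ x, f x ∂ν ≤ ∫ x, f x ∂ξ

end

end TwoLayerLoss

/-!
The number `Y` of class-`k` customers in the system leaves the value `j` upwards at rate `lam k`,
unless the state is blocking, and downwards at rate `mu k * j`. In equilibrium the flows between
`{Y ≤ j}` and its complement balance (`cut_balance`), so with `ρ = lam k / mu k`
`(j + 1) P(Y = j + 1) ≤ ρ P(Y = j)`, and equality holds for `j < m k`, because a free layer-1 server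
then excludes blocking. The weights `ρ ^ j / j!` satisfy this with equality for all `j`. Hence the law
of `Y` is below `Erl(m k + n, ρ)` in the likelihood ratio order, and above `Erl(m k, ρ)`, which is its
conditional law given `Y ≤ m k`. The likelihood ratio order implies the comparison of means of all
monotone functions (`sum_mul_le_sum_mul_of_likelihoodRatio`), which gives the stochastic order and
the bounds on the mean and on the throughput. Both in the loss system and in the Erlang system the
mean equals `ρ` times the acceptance probability (`meanNumber_eq_mul`, `erlMean_eq_mul`), so the
bounds on the means turn into the reversed bounds on the blocking probabilities.

Stationarity under `exp (t Q)` is the linear equation `π Q = 0`. As `Q` is singular this has a signed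
solution, and the absolute value of a solution is again a solution (`abs_vecMul_eq_zero`); this gives
existence. For uniqueness, the positive and negative parts of the difference of two stationary laws
are stationary and one of them vanishes at the empty state; it then vanishes everywhere, because
service completions lead from every state to the empty one (`eq_zero_of_emptyState`).
-/

namespace TwoLayerLoss

open Finset

/-! ### Stationary distributions as null vectors of the generator -/

section Markov

variable {S : Type*} [Fintype S] [DecidableEq S]

theorem sum_generatorOfRates_mul (r : S → S → ℝ) (f : S → ℝ) (x : S) :
    ∑ y, generatorOfRates r x y * f y = ∑ y, r x y * (f y - f x) := by
  rw [← Finset.add_sum_erase _ _ (mem_univ x),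
    ← Finset.add_sum_erase univ (fun y => r x y * (f y - f x)) (mem_univ x)]
  have h : ∑ y ∈ univ.erase x, generatorOfRates r x y * f y = ∑ y ∈ univ.erase x, r x y * f y := by
    refine Finset.sum_congr rfl fun y hy => ?_
    simp [generatorOfRates, (Finset.ne_of_mem_erase hy).symm]
  rw [h]
  simp only [generatorOfRates, if_true, mul_sub, Finset.sum_sub_distrib, Finset.sum_mul, neg_mul,
    sub_self]
  ring

theorem sum_generatorOfRates (r : S → S → ℝ) (x : S) : ∑ y, generatorOfRates r x y = 0 := by
  simpa using sum_generatorOfRates_mul r (fun _ => 1) x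

open scoped Matrix.Norms.Operator in
theorem hasDerivAt_transition (Q : Matrix S S ℝ) (x y : S) :
    HasDerivAt (fun t => transition Q t x y) (Q x y) 0 := by
  have h := hasDerivAt_exp_smul_const (𝕂 := ℝ) Q (0 : ℝ)
  rw [zero_smul, NormedSpace.exp_zero, one_mul] at h
  exact hasDerivAt_pi.1 (hasDerivAt_pi.1 h x) y

open scoped Matrix.Norms.Operator in
theorem vecMul_transition_of_vecMul_eq_zero {Q : Matrix S S ℝ} {v : S → ℝ}
    (hv : ∀ y, ∑ x, v x * Q x y = 0) (t : ℝ) (y : S) :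
    ∑ x, v x * transition Q t x y = v y := by
  -- The square matrix `V` with all rows equal to `v` satisfies `V * (t • Q) = 0 * V`, and this
  -- intertwining passes to exponentials.
  let V : Matrix S S ℝ := fun _ => v
  have h : SemiconjBy V (t • Q) 0 := by
    change V * (t • Q) = 0 * V
    rw [Matrix.mul_smul, zero_mul, show V * Q = 0 from Matrix.ext fun _ b => hv b, smul_zero]
  have h' := congrFun (congrFun h.exp_right.eq y) y
  rw [NormedSpace.exp_zero, one_mul, Matrix.mul_apply] at h'
  exact h'

theorem IsStationaryDist.vecMul_eq_zero [MeasurableSpace S] {Q : Matrix S S ℝ} {π : Measure S}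
    (h : IsStationaryDist Q π) (y : S) : ∑ x, π.real {x} * Q x y = 0 := by
  have hd : HasDerivAt (fun t => ∑ x, π.real {x} * transition Q t x y)
      (∑ x, π.real {x} * Q x y) 0 :=
    HasDerivAt.fun_sum fun x _ => (hasDerivAt_transition Q x y).const_mul _
  -- Invariance is known for `t ≥ 0` only, so the derivatives are compared from the right.
  have hc : HasDerivWithinAt (fun t => ∑ x, π.real {x} * transition Q t x y) 0 (Set.Ici 0) 0 :=
    (hasDerivWithinAt_const (0 : ℝ) (Set.Ici 0) (π.real {y})).congr
      (fun t ht => h.invariant t ht y) (h.invariant 0 le_rfl y)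
  exact (uniqueDiffWithinAt_Ici (0 : ℝ)).eq_deriv _ hd.hasDerivWithinAt hc

/-- The absolute value of a signed stationary vector is stationary: the triangle inequality gives
`0 ≤ |v| Q` entrywise, and the entries of `|v| Q` add up to zero. -/
theorem abs_vecMul_eq_zero {Q : Matrix S S ℝ} (hoff : ∀ x y, x ≠ y → 0 ≤ Q x y)
    (hrow : ∀ x, ∑ y, Q x y = 0) {v : S → ℝ} (hv : ∀ y, ∑ x, v x * Q x y = 0) (y : S) :
    ∑ x, |v x| * Q x y = 0 := by
  have hdiag : ∀ y, Q y y ≤ 0 := fun y => by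
    have h := hrow y
    rw [← Finset.add_sum_erase _ _ (mem_univ y)] at h
    have : 0 ≤ ∑ z ∈ univ.erase y, Q y z :=
      Finset.sum_nonneg fun z hz => hoff y z (Finset.ne_of_mem_erase hz).symm
    linarith
  have hnonneg : ∀ y, 0 ≤ ∑ x, |v x| * Q x y := fun y => by
    have h := hv y
    rw [← Finset.add_sum_erase _ _ (mem_univ y)] at h ⊢
    have h1 : |∑ x ∈ univ.erase y, v x * Q x y| ≤ ∑ x ∈ univ.erase y, |v x| * Q x y := by
      refine (Finset.abs_sum_le_sum_abs _ _).trans_eq (Finset.sum_congr rfl fun x hx => ?_)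
      rw [abs_mul, abs_of_nonneg (hoff x y (Finset.ne_of_mem_erase hx))]
    have h2 : |∑ x ∈ univ.erase y, v x * Q x y| = -(|v y| * Q y y) := by
      rw [show ∑ x ∈ univ.erase y, v x * Q x y = -(v y * Q y y) by linarith, abs_neg, abs_mul,
        abs_of_nonpos (hdiag y), mul_neg]
    linarith
  have hsum : ∑ y, ∑ x, |v x| * Q x y = 0 := by
    rw [Finset.sum_comm]
    simp [← Finset.mul_sum, hrow]
  exact (Finset.sum_eq_zero_iff_of_nonneg fun y _ => hnonneg y).1 hsum y (mem_univ y)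

theorem exists_stationary_vector [Nonempty S] {Q : Matrix S S ℝ}
    (hoff : ∀ x y, x ≠ y → 0 ≤ Q x y) (hrow : ∀ x, ∑ y, Q x y = 0) :
    ∃ w : S → ℝ, (∀ x, 0 ≤ w x) ∧ ∑ x, w x = 1 ∧ ∀ y, ∑ x, w x * Q x y = 0 := by
  have hdet : Q.det = 0 := Matrix.exists_mulVec_eq_zero_iff.1
    ⟨fun _ => 1, Function.const_ne_zero.2 (one_ne_zero (α := ℝ)), by
      ext x; simp [Matrix.mulVec, dotProduct, hrow]⟩
  obtain ⟨v, hv0, hv⟩ := Matrix.exists_vecMul_eq_zero_iff.2 hdet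
  have habs := abs_vecMul_eq_zero hoff hrow (v := v) fun y => by
    simpa [Matrix.vecMul, dotProduct] using congrFun hv y
  obtain ⟨z, hz⟩ := Function.ne_iff.1 hv0
  have hpos : 0 < ∑ x, |v x| :=
    Finset.sum_pos' (fun x _ => abs_nonneg _) ⟨z, mem_univ z, abs_pos.2 hz⟩
  refine ⟨fun x => (∑ x, |v x|)⁻¹ * |v x|, fun x => by positivity, ?_, fun y => ?_⟩
  · rw [← Finset.mul_sum, inv_mul_cancel₀ hpos.ne']
  · simp only [mul_assoc]
    rw [← Finset.mul_sum, habs y, mul_zero]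

/-- If every nonnegative stationary vector vanishing at a fixed state `o` is zero, then a signed
stationary vector of total mass zero is zero: its positive and negative parts are stationary, and
one of them vanishes at `o`. -/
theorem eq_zero_of_sum_eq_zero {Q : Matrix S S ℝ}
    (hoff : ∀ x y, x ≠ y → 0 ≤ Q x y) (hrow : ∀ x, ∑ y, Q x y = 0) (o : S)
    (ho : ∀ w : S → ℝ, (∀ x, 0 ≤ w x) → (∀ y, ∑ x, w x * Q x y = 0) → w o = 0 → ∀ x, w x = 0)
    {v : S → ℝ} (hv : ∀ y, ∑ x, v x * Q x y = 0) (hsum : ∑ x, v x = 0) (x : S) : v x = 0 := by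
  have habs := abs_vecMul_eq_zero hoff hrow hv
  rcases le_total 0 (v o) with h | h
  · have h0 := ho (fun x => |v x| - v x) (fun x => sub_nonneg.2 (le_abs_self _))
      (fun y => by simp only [sub_mul, Finset.sum_sub_distrib, habs, hv, sub_self])
      (by simp [abs_of_nonneg h])
    have hnn : ∀ x, 0 ≤ v x := fun x => by have := h0 x; have := abs_nonneg (v x); linarith
    exact (Finset.sum_eq_zero_iff_of_nonneg fun x _ => hnn x).1 hsum x (mem_univ x)
  · have h0 := ho (fun x => |v x| + v x) (fun x => by have := neg_abs_le (v x); linarith)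
      (fun y => by simp only [add_mul, Finset.sum_add_distrib, habs, hv, add_zero])
      (by simp [abs_of_nonpos h])
    have hnp : ∀ x, v x ≤ 0 := fun x => by have := h0 x; have := abs_nonneg (v x); linarith
    exact (Finset.sum_eq_zero_iff_of_nonpos fun x _ => hnp x).1 hsum x (mem_univ x)

theorem existsUnique_isStationaryDist [MeasurableSpace S] [MeasurableSingletonClass S]
    {Q : Matrix S S ℝ} (hoff : ∀ x y, x ≠ y → 0 ≤ Q x y) (hrow : ∀ x, ∑ y, Q x y = 0) (o : S)
    (ho : ∀ w : S → ℝ, (∀ x, 0 ≤ w x) → (∀ y, ∑ x, w x * Q x y = 0) → w o = 0 → ∀ x, w x = 0) :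
    ∃! π : Measure S, IsStationaryDist Q π := by
  have : Nonempty S := ⟨o⟩
  obtain ⟨w, hw0, hw1, hw⟩ := exists_stationary_vector hoff hrow
  have hreal : ∀ y, (∑ x, ENNReal.ofReal (w x) • Measure.dirac x : Measure S).real {y} = w y := by
    intro y
    have : (∑ x, ENNReal.ofReal (w x) • Measure.dirac x : Measure S) {y}
        = ENNReal.ofReal (w y) := by
      simp [Measure.finsetSum_apply, Set.indicator_apply]
    rw [measureReal_def, this, ENNReal.toReal_ofReal (hw0 y)]
  refine ⟨∑ x, ENNReal.ofReal (w x) • Measure.dirac x, ⟨⟨?_⟩, fun t _ y => ?_⟩, fun ν hν => ?_⟩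
  · simp [Measure.finsetSum_apply, ← ENNReal.ofReal_sum_of_nonneg fun x _ => hw0 x, hw1]
  · simp only [hreal]
    exact vecMul_transition_of_vecMul_eq_zero hw t y
  · have := hν.isProbabilityMeasure
    have hν1 : ∑ x, ν.real {x} = 1 := by
      rw [sum_measureReal_singleton, coe_univ, probReal_univ]
    have h0 := eq_zero_of_sum_eq_zero hoff hrow o ho (v := fun x => ν.real {x} - w x)
      (fun y => by simp only [sub_mul, Finset.sum_sub_distrib, hw, hν.vecMul_eq_zero, sub_self])
      (by rw [Finset.sum_sub_distrib, hν1, hw1, sub_self])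
    refine Measure.ext_of_singleton fun x => ?_
    have hx : (∑ x, ENNReal.ofReal (w x) • Measure.dirac x : Measure S) {x}
        = ENNReal.ofReal (w x) := by
      simp [Measure.finsetSum_apply, Set.indicator_apply]
    rw [hx, ← sub_eq_zero.1 (h0 x), ofReal_measureReal]

end Markov

/-! ### Transitions of the loss system -/

section Model

variable {K : ℕ} {m : Fin K → ℕ} {n : ℕ}

/-- The number of class-`k` customers in the system, as a natural number. -/
def count (k : Fin K) (x : State m n) : ℕ := x.1 0 k + x.1 1 k

theorem classCount_eq (k : Fin K) (x : State m n) : classCount k x = (count k x : ℝ) := by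
  simp [classCount, count]

theorem count_le (k : Fin K) (x : State m n) : count k x ≤ m k + n :=
  add_le_add (x.2.1 k) ((Finset.single_le_sum (f := x.1 1) (fun _ _ => Nat.zero_le _)
    (mem_univ k)).trans x.2.2)

theorem unitVec_apply (i j : Fin 2) (k l : Fin K) :
    unitVec i k j l = if j = i ∧ l = k then 1 else 0 := by
  unfold unitVec
  by_cases hj : j = i
  · subst hj
    simp [Pi.single_apply]
  · simp [hj]

theorem count_add_unitVec {x y : State m n} {i : Fin 2} {l : Fin K}
    (h : y.1 = x.1 + unitVec i l) (k : Fin K) :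
    count k y = count k x + if l = k then 1 else 0 := by
  simp only [count, h, Pi.add_apply, unitVec_apply, eq_comm (a := k)]
  fin_cases i <;> by_cases hl : l = k <;> simp [hl] <;> omega

theorem sum_unitVec (i j : Fin 2) (k : Fin K) :
    ∑ l, unitVec i k j l = if j = i then 1 else 0 := by
  by_cases h : j = i <;> simp [unitVec_apply, h]

theorem exists_add_unitVec {i : Fin 2} {k : Fin K} {x : State m n} (hx : x ∈ acceptSet m n i k) :
    ∃ y : State m n, y.1 = x.1 + unitVec i k := by
  refine ⟨⟨x.1 + unitVec i k, fun l => ?_, ?_⟩, rfl⟩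
  · have := x.2.1 l
    fin_cases i
    · have hx' : x.1 0 k < m k := hx
      by_cases hl : l = k
      · subst hl; simpa [unitVec_apply] using hx'
      · simpa [unitVec_apply, hl] using this
    · simpa [unitVec_apply] using this
  · have := x.2.2
    simp only [Pi.add_apply, Finset.sum_add_distrib, sum_unitVec]
    fin_cases i
    · simpa using this
    · have hx' : ∑ l, x.1 1 l < n := hx.2
      simpa using hx'

theorem exists_eq_add_unitVec {i : Fin 2} {k : Fin K} {x : State m n} (hx : 0 < x.1 i k) :
    ∃ y : State m n, x.1 = y.1 + unitVec i k := by
  refine ⟨⟨x.1 - unitVec i k, fun l => (Nat.sub_le _ _).trans (x.2.1 l),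
    (Finset.sum_le_sum fun l _ => Nat.sub_le _ _).trans x.2.2⟩, ?_⟩
  ext j l
  simp only [Pi.add_apply, Pi.sub_apply, unitVec_apply]
  by_cases h : j = i ∧ l = k
  · obtain ⟨rfl, rfl⟩ := h
    simp; omega
  · simp [h]

variable {lam mu : Fin K → ℝ}

theorem upRate_nonneg (hlam : ∀ k, 0 < lam k) (i : Fin 2) (k : Fin K) (x : State m n) :
    0 ≤ upRate lam i k x :=
  Set.indicator_nonneg (fun _ _ => (hlam k).le) x

theorem downRate_nonneg (hmu : ∀ k, 0 < mu k) (i : Fin 2) (k : Fin K) (x : State m n) :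
    0 ≤ downRate mu i k x :=
  mul_nonneg (hmu k).le (Nat.cast_nonneg _)

theorem jumpRate_nonneg (hlam : ∀ k, 0 < lam k) (hmu : ∀ k, 0 < mu k) (x y : State m n) :
    0 ≤ jumpRate lam mu x y := by
  refine Finset.sum_nonneg fun i _ => Finset.sum_nonneg fun k _ => add_nonneg ?_ ?_ <;> split_ifs
  exacts [upRate_nonneg hlam i k x, le_rfl, downRate_nonneg hmu i k x, le_rfl]

theorem downRate_le_jumpRate (hlam : ∀ k, 0 < lam k) (hmu : ∀ k, 0 < mu k) {x y : State m n}
    {i : Fin 2} {k : Fin K} (h : x.1 = y.1 + unitVec i k) :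
    downRate mu i k x ≤ jumpRate lam mu x y := by
  have hup : ∀ i k, 0 ≤ (if y.1 = x.1 + unitVec i k then upRate lam i k x else 0) := by
    intro i k; split_ifs
    exacts [upRate_nonneg hlam i k x, le_rfl]
  have hdown : ∀ i k, 0 ≤ (if x.1 = y.1 + unitVec i k then downRate mu i k x else 0) := by
    intro i k; split_ifs
    exacts [downRate_nonneg hmu i k x, le_rfl]
  calc downRate mu i k x = (if x.1 = y.1 + unitVec i k then downRate mu i k x else 0) := by
        rw [if_pos h]
    _ ≤ (if y.1 = x.1 + unitVec i k then upRate lam i k x else 0) +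
        (if x.1 = y.1 + unitVec i k then downRate mu i k x else 0) := le_add_of_nonneg_left (hup i k)
    _ ≤ ∑ k, ((if y.1 = x.1 + unitVec i k then upRate lam i k x else 0) +
        (if x.1 = y.1 + unitVec i k then downRate mu i k x else 0)) :=
      Finset.single_le_sum (f := fun k => (if y.1 = x.1 + unitVec i k then upRate lam i k x else 0) +
        (if x.1 = y.1 + unitVec i k then downRate mu i k x else 0))
        (fun k _ => add_nonneg (hup i k) (hdown i k)) (mem_univ k)
    _ ≤ jumpRate lam mu x y :=
      Finset.single_le_sum
        (f := fun i => ∑ k, ((if y.1 = x.1 + unitVec i k then upRate lam i k x else 0) +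
          (if x.1 = y.1 + unitVec i k then downRate mu i k x else 0)))
        (fun i _ => Finset.sum_nonneg fun k _ => add_nonneg (hup i k) (hdown i k)) (mem_univ i)

theorem generator_nonneg (hlam : ∀ k, 0 < lam k) (hmu : ∀ k, 0 < mu k) (x y : State m n)
    (h : x ≠ y) : 0 ≤ generator m n lam mu x y := by
  simpa [generator, generatorOfRates, h] using jumpRate_nonneg hlam hmu x y

/-- The empty system. -/
def emptyState : State m n := ⟨0, fun _ => Nat.zero_le _, by simp⟩

/-- The empty state can be reached from every state by service completions, so a nonnegative
stationary vector that vanishes there vanishes everywhere. -/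
theorem eq_zero_of_emptyState (hlam : ∀ k, 0 < lam k) (hmu : ∀ k, 0 < mu k)
    (w : State m n → ℝ) (hw0 : ∀ x, 0 ≤ w x) (hw : ∀ y, ∑ x, w x * generator m n lam mu x y = 0)
    (ho : w emptyState = 0) (x : State m n) : w x = 0 := by
  induction hN : ∑ i, ∑ k, x.1 i k generalizing x with
  | zero =>
    have : x = emptyState := by
      refine Subtype.ext ?_
      ext i k
      simp only [Finset.sum_eq_zero_iff, mem_univ, true_imp_iff] at hN
      exact hN i k
    rw [this, ho]
  | succ N ih =>
    obtain ⟨i, k, hik⟩ : ∃ i k, 0 < x.1 i k := by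
      by_contra! hcon
      have : ∑ i, ∑ k, x.1 i k = 0 :=
        Finset.sum_eq_zero fun i _ => Finset.sum_eq_zero fun k _ => Nat.le_zero.1 (hcon i k)
      omega
    obtain ⟨y, hy⟩ := exists_eq_add_unitVec hik
    have hne : x ≠ y := by
      rintro rfl
      have := congrFun (congrFun hy i) k
      simp [unitVec_apply] at this
    have hwy : w y = 0 := by
      refine ih y ?_
      rw [hy] at hN
      simp only [Pi.add_apply, Finset.sum_add_distrib, sum_unitVec, Finset.sum_ite_eq',
        mem_univ, if_true] at hN
      omega
    have hterm : ∀ z ∈ univ, 0 ≤ w z * generator m n lam mu z y := by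
      intro z _
      by_cases hz : z = y
      · rw [hz, hwy, zero_mul]
      · exact mul_nonneg (hw0 z) (generator_nonneg hlam hmu z y hz)
    have hx := (Finset.sum_eq_zero_iff_of_nonneg hterm).1 (hw y) x (mem_univ x)
    have hpos : 0 < generator m n lam mu x y := by
      have h1 : 0 < downRate mu i k x := mul_pos (hmu k) (Nat.cast_pos.2 hik)
      have h2 := downRate_le_jumpRate hlam hmu hy
      simpa [generator, generatorOfRates, hne] using h1.trans_le h2
    exact (mul_eq_zero.1 hx).resolve_right hpos.ne'

/-! ### Balance equations for the number of customers of one class -/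

theorem sum_upRate_mul (g : ℕ → ℝ) (k l : Fin K) (i : Fin 2) (x : State m n) :
    ∑ y : State m n, (if y.1 = x.1 + unitVec i l then upRate lam i l x else 0) *
      (g (count k y) - g (count k x)) =
    if l = k then upRate lam i l x * (g (count k x + 1) - g (count k x)) else 0 := by
  by_cases hx : x ∈ acceptSet m n i l
  · obtain ⟨y, hy⟩ := exists_add_unitVec hx
    rw [Finset.sum_eq_single y _ (by simp), if_pos hy, count_add_unitVec hy]
    · split_ifs <;> simp
    · intro z _ hz
      rw [if_neg (fun h => hz (Subtype.ext (h.trans hy.symm))), zero_mul]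
  · simp [upRate, hx]

theorem sum_downRate_mul (g : ℕ → ℝ) (k l : Fin K) (i : Fin 2) (x : State m n) :
    ∑ y : State m n, (if x.1 = y.1 + unitVec i l then downRate mu i l x else 0) *
      (g (count k y) - g (count k x)) =
    if l = k then downRate mu i l x * (g (count k x - 1) - g (count k x)) else 0 := by
  rcases Nat.eq_zero_or_pos (x.1 i l) with hx | hx
  · simp [downRate, hx]
  · obtain ⟨y, hy⟩ := exists_eq_add_unitVec hx
    rw [Finset.sum_eq_single y _ (by simp), if_pos hy, count_add_unitVec hy]
    · split_ifs <;> simp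
    · intro z _ hz
      rw [if_neg (fun h => hz (Subtype.ext (add_right_cancel (h.symm.trans hy)))), zero_mul]

open Classical in
theorem sum_upRate (k : Fin K) (x : State m n) :
    ∑ i, upRate lam i k x = if x ∈ blockSet m n k then 0 else lam k := by
  have h1 := x.2.1 k
  have h2 := x.2.2
  have hb : x ∈ blockSet m n k ↔ x.1 0 k = m k ∧ ∑ l, x.1 1 l = n := Iff.rfl
  rw [if_congr hb rfl rfl]
  simp only [Fin.sum_univ_two, upRate, Set.indicator_apply, acceptSet, Set.mem_ofPred_eq]
  split_ifs <;> first | omega | simp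

theorem sum_downRate (k : Fin K) (x : State m n) :
    ∑ i, downRate mu i k x = mu k * count k x := by
  simp [Fin.sum_univ_two, downRate, count, mul_add]

open Classical in
/-- The generator applied to a function of the number of class-`k` customers: that number behaves
like a birth-death chain, except that its births are suppressed in the blocking states. -/
theorem generator_apply_count (g : ℕ → ℝ) (k : Fin K) (x : State m n) :
    ∑ y, generator m n lam mu x y * g (count k y) =
      (if x ∈ blockSet m n k then 0 else lam k) * (g (count k x + 1) - g (count k x)) +
      mu k * count k x * (g (count k x - 1) - g (count k x)) := by
  rw [generator, sum_generatorOfRates_mul (jumpRate lam mu) (fun y => g (count k y)),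
    ← sum_upRate, ← sum_downRate]
  simp only [jumpRate, Finset.sum_mul]
  rw [Finset.sum_comm, ← Finset.sum_add_distrib]
  refine Finset.sum_congr rfl fun i _ => ?_
  rw [Finset.sum_comm]
  simp only [add_mul, Finset.sum_add_distrib, sum_upRate_mul, sum_downRate_mul,
    Finset.sum_ite_eq', mem_univ, if_true]

open Classical in
theorem stationary_balance {w : State m n → ℝ}
    (hw : ∀ y, ∑ x, w x * generator m n lam mu x y = 0) (g : ℕ → ℝ) (k : Fin K) :
    ∑ x, w x * ((if x ∈ blockSet m n k then 0 else lam k) * (g (count k x + 1) - g (count k x)) +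
      mu k * count k x * (g (count k x - 1) - g (count k x))) = 0 := by
  simp only [← generator_apply_count, Finset.mul_sum]
  rw [Finset.sum_comm]
  simp only [← mul_assoc, ← Finset.sum_mul, hw, zero_mul, Finset.sum_const_zero]

/-- The mass that `w` gives to the states with exactly `j` class-`k` customers. -/
noncomputable def countMass (w : State m n → ℝ) (k : Fin K) (j : ℕ) : ℝ :=
  ∑ x, if count k x = j then w x else 0

theorem sum_mul_count (w : State m n → ℝ) (k : Fin K) (f : ℕ → ℝ) :
    ∑ x, w x * f (count k x) = ∑ j ∈ range (m k + n + 1), countMass w k j * f j := by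
  simp only [countMass, Finset.sum_mul, ite_mul, zero_mul]
  rw [Finset.sum_comm]
  refine Finset.sum_congr rfl fun x _ => ?_
  have := count_le k x
  rw [Finset.sum_ite_eq, if_pos (mem_range.2 (by omega))]

open Classical in
/-- The flow from `j` to `j + 1` class-`k` customers equals the flow back. -/
theorem cut_balance {w : State m n → ℝ}
    (hw : ∀ y, ∑ x, w x * generator m n lam mu x y = 0) (k : Fin K) (j : ℕ) :
    lam k * ∑ x, (if count k x = j ∧ x ∉ blockSet m n k then w x else 0) =
      mu k * ((j + 1 : ℕ) * countMass w k (j + 1)) := by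
  have h := stationary_balance hw (fun i => if j + 1 ≤ i then 1 else 0) k
  rw [countMass, Finset.mul_sum, Finset.mul_sum, Finset.mul_sum, ← sub_eq_zero,
    ← Finset.sum_sub_distrib]
  refine (Finset.sum_congr rfl fun x _ => ?_).trans h
  rcases lt_trichotomy (count k x) j with hj | hj | hj
  · simp [hj.ne, show count k x ≠ j + 1 by omega, show ¬ j ≤ count k x by omega,
      show ¬ j < count k x by omega, show ¬ j < count k x - 1 by omega]
  · simp [hj, mul_comm, show ¬ j < j - 1 by omega]
  · rcases (Nat.succ_le_of_lt hj).eq_or_lt with hj' | hj'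
    · simp [← hj']
      ring
    · simp [show count k x ≠ j by omega, show count k x ≠ j + 1 by omega,
        show j ≤ count k x by omega, hj, show j < count k x - 1 by omega]

theorem countMass_succ_le (hlam : ∀ k, 0 < lam k) {w : State m n → ℝ} (hw0 : ∀ x, 0 ≤ w x)
    (hw : ∀ y, ∑ x, w x * generator m n lam mu x y = 0) (k : Fin K) (j : ℕ) :
    mu k * ((j + 1 : ℕ) * countMass w k (j + 1)) ≤ lam k * countMass w k j := by
  classical
  rw [← cut_balance hw]
  refine mul_le_mul_of_nonneg_left (Finset.sum_le_sum fun x _ => ?_) (hlam k).le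
  by_cases h : count k x = j <;> by_cases hb : x ∈ blockSet m n k <;> simp [h, hb, hw0]

/-- With fewer than `m k` class-`k` customers present, some server of layer 1 is free for them, so
nothing is lost in the cut equation. -/
theorem countMass_succ_eq {w : State m n → ℝ}
    (hw : ∀ y, ∑ x, w x * generator m n lam mu x y = 0) (k : Fin K) {j : ℕ} (hj : j < m k) :
    mu k * ((j + 1 : ℕ) * countMass w k (j + 1)) = lam k * countMass w k j := by
  classical
  rw [← cut_balance hw, countMass]
  congr 1
  refine Finset.sum_congr rfl fun x _ => ?_
  refine if_congr ⟨fun h => h.1, fun h => ⟨h, fun hb => ?_⟩⟩ rfl rfl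
  have h1 : x.1 0 k = m k := hb.1
  simp only [count] at h
  omega

end Model

/-! ### Likelihood ratio order -/

/-- A likelihood ratio comparison of two probability vectors on `{0, …, N - 1}` gives the comparison
of the means of monotone functions. -/
theorem sum_mul_le_sum_mul_of_likelihoodRatio {N : ℕ} {p q f : ℕ → ℝ}
    (hp : ∑ i ∈ range N, p i = 1) (hq : ∑ i ∈ range N, q i = 1)
    (hpq : ∀ i j, i ≤ j → j < N → p j * q i ≤ p i * q j) (hf : Monotone f) :
    ∑ i ∈ range N, p i * f i ≤ ∑ i ∈ range N, q i * f i := by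
  have e1 : ∑ i ∈ range N, q i * f i - ∑ i ∈ range N, p i * f i
      = ∑ i ∈ range N, ∑ j ∈ range N, p i * q j * (f j - f i) := by
    simp only [mul_sub, Finset.sum_sub_distrib]
    congr 1
    · simp only [mul_assoc, ← Finset.mul_sum]
      rw [← Finset.sum_mul, hp, one_mul]
    · refine Finset.sum_congr rfl fun i _ => ?_
      rw [← Finset.sum_mul, ← Finset.mul_sum, hq, mul_one]
  -- Adding the same double sum with `i` and `j` exchanged makes every term nonnegative.
  have e2 : 2 * (∑ i ∈ range N, q i * f i - ∑ i ∈ range N, p i * f i)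
      = ∑ i ∈ range N, ∑ j ∈ range N, (p i * q j - p j * q i) * (f j - f i) := by
    rw [two_mul]
    nth_rewrite 2 [e1]
    rw [Finset.sum_comm, e1, ← Finset.sum_add_distrib]
    refine Finset.sum_congr rfl fun i _ => ?_
    rw [← Finset.sum_add_distrib]
    exact Finset.sum_congr rfl fun j _ => by ring
  have e3 : 0 ≤ ∑ i ∈ range N, ∑ j ∈ range N, (p i * q j - p j * q i) * (f j - f i) := by
    refine Finset.sum_nonneg fun i hi => Finset.sum_nonneg fun j hj => ?_
    rcases le_total i j with h | h
    · exact mul_nonneg (sub_nonneg.2 (hpq i j h (mem_range.1 hj))) (sub_nonneg.2 (hf h))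
    · exact mul_nonneg_of_nonpos_of_nonpos (sub_nonpos.2 (hpq j i h (mem_range.1 hi)))
        (sub_nonpos.2 (hf h))
  linarith

/-! ### The Erlang distribution -/

section Erlang

variable {ρ : ℝ}

theorem erlWeight_nonneg (hρ : 0 < ρ) (s i : ℕ) : 0 ≤ erlWeight s ρ i := by
  unfold erlWeight
  positivity

theorem sum_erlWeight (hρ : 0 < ρ) (s : ℕ) : ∑ i ∈ range (s + 1), erlWeight s ρ i = 1 := by
  have : 0 < ∑ j ∈ range (s + 1), ρ ^ j / (j.factorial : ℝ) :=
    Finset.sum_pos (fun j _ => by positivity) (by simp)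
  simp only [erlWeight, ← Finset.mul_sum]
  exact inv_mul_cancel₀ this.ne'

theorem succ_mul_erlWeight_succ (s i : ℕ) :
    ((i + 1 : ℕ) : ℝ) * erlWeight s ρ (i + 1) = ρ * erlWeight s ρ i := by
  have h1 : ((i + 1 : ℕ) : ℝ) ≠ 0 := by positivity
  have h2 : (i.factorial : ℝ) ≠ 0 := by positivity
  simp only [erlWeight, Nat.factorial_succ, Nat.cast_mul, pow_succ]
  field_simp

theorem integral_erl (hρ : 0 < ρ) (s : ℕ) (f : ℝ → ℝ) :
    ∫ x, f x ∂(erl s ρ) = ∑ i ∈ range (s + 1), erlWeight s ρ i * f i := by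
  rw [erl, integral_finsetSum_measure]
  · refine Finset.sum_congr rfl fun i _ => ?_
    rw [integral_smul_measure, integral_dirac, ENNReal.toReal_ofReal (erlWeight_nonneg hρ s i),
      smul_eq_mul]
  · intro i _
    exact (integrable_dirac (by simp)).smul_measure ENNReal.ofReal_ne_top

theorem erlMean_eq (hρ : 0 < ρ) (s : ℕ) :
    erlMean s ρ = ∑ i ∈ range (s + 1), erlWeight s ρ i * i :=
  integral_erl hρ s fun x => x

theorem erlBlocking_eq (hρ : 0 < ρ) (s : ℕ) : erlBlocking s ρ = erlWeight s ρ s := by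
  have h : (erl s ρ) {(s : ℝ)} = ENNReal.ofReal (erlWeight s ρ s) := by
    rw [erl, Measure.finsetSum_apply, Finset.sum_eq_single s]
    · simp
    · intro i _ hi
      simp [hi]
    · simp
  rw [erlBlocking, measureReal_def, h, ENNReal.toReal_ofReal (erlWeight_nonneg hρ s s)]

/-- Flow balance in the Erlang loss system: the mean number of customers is the accepted load. -/
theorem erlMean_eq_mul (hρ : 0 < ρ) (s : ℕ) : erlMean s ρ = ρ * (1 - erlBlocking s ρ) := by
  rw [erlMean_eq hρ, erlBlocking_eq hρ, Finset.sum_range_succ']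
  have h := sum_erlWeight hρ s
  rw [Finset.sum_range_succ] at h
  rw [← h, add_sub_cancel_right, Finset.mul_sum, Nat.cast_zero, mul_zero, add_zero]
  exact Finset.sum_congr rfl fun i _ => by rw [mul_comm, succ_mul_erlWeight_succ]

/-- A law whose mass ratios of neighbouring points are at most those of the Poisson law is below the
truncated Poisson law `Erl(s, ρ)` in the likelihood ratio order. -/
theorem mul_erlWeight_le (hρ : 0 < ρ) (s : ℕ) {q : ℕ → ℝ}
    (hq : ∀ j : ℕ, ((j + 1 : ℕ) : ℝ) * q (j + 1) ≤ ρ * q j) {i j : ℕ} (hij : i ≤ j) :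
    q j * erlWeight s ρ i ≤ q i * erlWeight s ρ j := by
  induction j, hij using Nat.le_induction with
  | base => exact le_rfl
  | succ j _ ih =>
    have hj : (0 : ℝ) < ((j + 1 : ℕ) : ℝ) := by positivity
    refine le_of_mul_le_mul_left ?_ hj
    calc ((j + 1 : ℕ) : ℝ) * (q (j + 1) * erlWeight s ρ i)
        = ((j + 1 : ℕ) * q (j + 1)) * erlWeight s ρ i := by ring
      _ ≤ ρ * q j * erlWeight s ρ i :=
        mul_le_mul_of_nonneg_right (hq j) (erlWeight_nonneg hρ s i)
      _ = ρ * (q j * erlWeight s ρ i) := by ring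
      _ ≤ ρ * (q i * erlWeight s ρ j) := mul_le_mul_of_nonneg_left ih hρ.le
      _ = q i * (ρ * erlWeight s ρ j) := by ring
      _ = ((j + 1 : ℕ) : ℝ) * (q i * erlWeight s ρ (j + 1)) := by
        rw [← succ_mul_erlWeight_succ]; ring

theorem mul_erlWeight_eq (s : ℕ) {q : ℕ → ℝ} {M : ℕ}
    (hq : ∀ j < M, ((j + 1 : ℕ) : ℝ) * q (j + 1) = ρ * q j) {i j : ℕ} (hij : i ≤ j) (hj : j ≤ M) :
    q j * erlWeight s ρ i = q i * erlWeight s ρ j := by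
  induction j, hij using Nat.le_induction with
  | base => rfl
  | succ j _ ih =>
    have hj0 : ((j + 1 : ℕ) : ℝ) ≠ 0 := by positivity
    refine mul_left_cancel₀ hj0 ?_
    rw [← mul_assoc, hq j hj, mul_assoc, ih (by omega), mul_left_comm, ← succ_mul_erlWeight_succ]
    ring

theorem sum_mul_le_sum_erlWeight_mul (hρ : 0 < ρ) {s : ℕ} {q f : ℕ → ℝ}
    (hq1 : ∑ j ∈ range (s + 1), q j = 1)
    (hq : ∀ j : ℕ, ((j + 1 : ℕ) : ℝ) * q (j + 1) ≤ ρ * q j) (hf : Monotone f) :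
    ∑ j ∈ range (s + 1), q j * f j ≤ ∑ j ∈ range (s + 1), erlWeight s ρ j * f j :=
  sum_mul_le_sum_mul_of_likelihoodRatio hq1 (sum_erlWeight hρ s)
    (fun _ _ hij _ => mul_erlWeight_le hρ s hq hij) hf

/-- A law on `{0, …, s}` which is proportional to the Poisson weights on `{0, …, M}` is above
`Erl(M, ρ)`, the law obtained by conditioning it on `{0, …, M}`. -/
theorem sum_erlWeight_mul_le_sum_mul (hρ : 0 < ρ) {M s : ℕ} (hM : M ≤ s) {q f : ℕ → ℝ}
    (hq0 : ∀ j, 0 ≤ q j) (hq1 : ∑ j ∈ range (s + 1), q j = 1)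
    (hq : ∀ j < M, ((j + 1 : ℕ) : ℝ) * q (j + 1) = ρ * q j) (hf : Monotone f) :
    ∑ j ∈ range (M + 1), erlWeight M ρ j * f j ≤ ∑ j ∈ range (s + 1), q j * f j := by
  -- `Erl(M, ρ)` as a vector on `{0, …, s}`; `erlWeight M ρ j` itself is positive for `j > M`.
  let p : ℕ → ℝ := fun j => if j < M + 1 then erlWeight M ρ j else 0
  have hp : ∀ h : ℕ → ℝ,
      ∑ j ∈ range (s + 1), p j * h j = ∑ j ∈ range (M + 1), erlWeight M ρ j * h j := by
    intro h
    rw [← Finset.sum_subset (Finset.range_subset_range.2 (Nat.succ_le_succ hM))]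
    · exact Finset.sum_congr rfl fun j hj => by simp only [p, if_pos (mem_range.1 hj)]
    · intro j _ hj
      simp only [p, if_neg (fun h => hj (mem_range.2 h)), zero_mul]
  rw [← hp f]
  refine sum_mul_le_sum_mul_of_likelihoodRatio ?_ hq1 (fun i j hij _ => ?_) hf
  · simpa [sum_erlWeight hρ M] using hp fun _ => 1
  · have hi0 : 0 ≤ p i := by
      simp only [p]; split_ifs
      exacts [erlWeight_nonneg hρ M i, le_rfl]
    by_cases hj : j < M + 1
    · have := mul_erlWeight_eq M hq hij (by omega)
      simp only [p, if_pos hj, if_pos (hij.trans_lt hj)]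
      linarith
    · simp only [p, if_neg hj, zero_mul]
      exact mul_nonneg hi0 (hq0 j)

end Erlang

/-! ### Comparison of the loss system with Erlang systems -/

section Comparison

variable {K : ℕ} {m : Fin K → ℕ} {n : ℕ} {lam mu : Fin K → ℝ} {π : Measure (State m n)}

instance : DiscreteMeasurableSpace (State m n) := ⟨fun _ => trivial⟩

theorem integral_comp_classCount [IsProbabilityMeasure π] (k : Fin K) (f : ℝ → ℝ) :
    ∫ x, f (classCount k x) ∂π
      = ∑ j ∈ range (m k + n + 1), countMass (fun x => π.real {x}) k j * f j := by
  rw [integral_fintype .of_finite, ← sum_mul_count _ k fun j => f j]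
  simp [classCount_eq]

theorem sum_countMass [IsProbabilityMeasure π] (k : Fin K) :
    ∑ j ∈ range (m k + n + 1), countMass (fun x => π.real {x}) k j = 1 := by
  simpa using (integral_comp_classCount (π := π) k fun _ => 1).symm

theorem countMass_nonneg (k : Fin K) (j : ℕ) : 0 ≤ countMass (fun x => π.real {x}) k j :=
  Finset.sum_nonneg fun x _ => by split_ifs; exacts [measureReal_nonneg, le_rfl]

theorem integral_comp_classCount_le (hlam : ∀ k, 0 < lam k) (hmu : ∀ k, 0 < mu k)
    (h : IsStationaryDist (generator m n lam mu) π) (k : Fin K) {f : ℝ → ℝ} (hf : Monotone f) :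
    ∫ x, f (classCount k x) ∂π ≤ ∫ x, f x ∂(erl (m k + n) (lam k / mu k)) := by
  have := h.isProbabilityMeasure
  have hρ := div_pos (hlam k) (hmu k)
  rw [integral_comp_classCount, integral_erl hρ]
  refine sum_mul_le_sum_erlWeight_mul (f := fun j => f j) hρ (sum_countMass k) (fun j => ?_)
    (hf.comp Nat.mono_cast)
  have := countMass_succ_le hlam (fun x => measureReal_nonneg (μ := π) (s := {x}))
    h.vecMul_eq_zero k j
  rw [div_mul_eq_mul_div, le_div_iff₀' (hmu k)]
  exact this

theorem le_integral_comp_classCount (hlam : ∀ k, 0 < lam k) (hmu : ∀ k, 0 < mu k)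
    (h : IsStationaryDist (generator m n lam mu) π) (k : Fin K) {f : ℝ → ℝ} (hf : Monotone f) :
    ∫ x, f x ∂(erl (m k) (lam k / mu k)) ≤ ∫ x, f (classCount k x) ∂π := by
  have := h.isProbabilityMeasure
  have hρ := div_pos (hlam k) (hmu k)
  rw [integral_comp_classCount, integral_erl hρ]
  refine sum_erlWeight_mul_le_sum_mul (f := fun j => f j) hρ (Nat.le_add_right _ n)
    (countMass_nonneg k) (sum_countMass k) (fun j hj => ?_) (hf.comp Nat.mono_cast)
  have := countMass_succ_eq h.vecMul_eq_zero k hj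
  rw [div_mul_eq_mul_div, eq_div_iff (hmu k).ne', mul_comm]
  exact this

theorem throughput_eq (k : Fin K) : throughput mu π k = mu k * meanNumber π k := by
  simp only [throughput, meanNumber, sum_downRate, classCount_eq, integral_const_mul]

/-- Flow balance: the mean number of class-`k` customers is the accepted load. -/
theorem meanNumber_eq_mul (hmu : ∀ k, 0 < mu k)
    (h : IsStationaryDist (generator m n lam mu) π) (k : Fin K) :
    meanNumber π k = lam k / mu k * (1 - blockingProb π k) := by
  classical
  have := h.isProbabilityMeasure
  have hbal := stationary_balance h.vecMul_eq_zero (fun j => (j : ℝ)) k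
  have hmean : meanNumber π k = ∑ x, π.real {x} * count k x := by
    rw [meanNumber, integral_fintype .of_finite]
    simp [classCount_eq]
  have hblock : 1 - blockingProb π k = ∑ x, π.real {x} * if x ∈ blockSet m n k then 0 else 1 := by
    rw [blockingProb, ← probReal_compl_eq_one_sub (Set.toFinite _).measurableSet,
      ← integral_indicator_one (Set.toFinite _).measurableSet, integral_fintype .of_finite]
    simp [Set.indicator_apply]
  have hterm : ∀ x : State m n, π.real {x} *
      ((if x ∈ blockSet m n k then 0 else lam k) * (((count k x + 1 : ℕ) : ℝ) - (count k x : ℕ)) +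
        mu k * count k x * (((count k x - 1 : ℕ) : ℝ) - (count k x : ℕ))) =
      lam k * (π.real {x} * if x ∈ blockSet m n k then 0 else 1) -
        mu k * (π.real {x} * count k x) := by
    intro x
    rcases hc : count k x with _ | c
    · split_ifs <;> simp [mul_comm]
    · split_ifs <;> simp <;> ring
  simp only [hterm, Finset.sum_sub_distrib, ← Finset.mul_sum, ← hblock, ← hmean] at hbal
  rw [div_mul_eq_mul_div, eq_div_iff (hmu k).ne']
  linarith

end Comparison

end TwoLayerLoss

theorem theorem7 (K : ℕ) (m : Fin K → ℕ) (n : ℕ) (lam mu : Fin K → ℝ)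
    (hlam : ∀ k, 0 < lam k) (hmu : ∀ k, 0 < mu k) :
    (∃! π : MeasureTheory.Measure (TwoLayerLoss.State m n),
      TwoLayerLoss.IsStationaryDist (TwoLayerLoss.generator m n lam mu) π) ∧
    ∀ π : MeasureTheory.Measure (TwoLayerLoss.State m n),
      TwoLayerLoss.IsStationaryDist (TwoLayerLoss.generator m n lam mu) π →
      ∀ k : Fin K,
        (TwoLayerLoss.StLE (TwoLayerLoss.erl (m k) (lam k / mu k))
            (π.map (TwoLayerLoss.classCount k)) ∧
          TwoLayerLoss.StLE (π.map (TwoLayerLoss.classCount k))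
            (TwoLayerLoss.erl (m k + n) (lam k / mu k))) ∧
        (TwoLayerLoss.erlMean (m k) (lam k / mu k) ≤ TwoLayerLoss.meanNumber π k ∧
          TwoLayerLoss.meanNumber π k ≤ TwoLayerLoss.erlMean (m k + n) (lam k / mu k)) ∧
        (mu k * TwoLayerLoss.erlMean (m k) (lam k / mu k) ≤ TwoLayerLoss.throughput mu π k ∧
          TwoLayerLoss.throughput mu π k ≤
            mu k * TwoLayerLoss.erlMean (m k + n) (lam k / mu k)) ∧
        (TwoLayerLoss.erlBlocking (m k + n) (lam k / mu k) ≤ TwoLayerLoss.blockingProb π k ∧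
          TwoLayerLoss.blockingProb π k ≤ TwoLayerLoss.erlBlocking (m k) (lam k / mu k)) := by
  open TwoLayerLoss in
  refine ⟨existsUnique_isStationaryDist (generator_nonneg hlam hmu)
    (sum_generatorOfRates (jumpRate lam mu)) emptyState (eq_zero_of_emptyState hlam hmu),
    fun π h k => ?_⟩
  have hρ := div_pos (hlam k) (hmu k)
  have hlow := le_integral_comp_classCount hlam hmu h k monotone_id
  have hupp := integral_comp_classCount_le hlam hmu h k monotone_id
  have hmap : ∀ f : ℝ → ℝ, Measurable f →
      ∫ x, f x ∂(π.map (classCount k)) = ∫ x, f (classCount k x) ∂π := fun f hf =>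
    MeasureTheory.integral_map Measurable.of_discrete.aemeasurable hf.aestronglyMeasurable
  refine ⟨⟨fun f hf hfm _ => ?_, fun f hf hfm _ => ?_⟩, ⟨hlow, hupp⟩, ?_, ?_⟩
  · rw [hmap f hfm]
    exact le_integral_comp_classCount hlam hmu h k hf
  · rw [hmap f hfm]
    exact integral_comp_classCount_le hlam hmu h k hf
  · rw [throughput_eq]
    exact ⟨mul_le_mul_of_nonneg_left hlow (hmu k).le, mul_le_mul_of_nonneg_left hupp (hmu k).le⟩
  · -- Both means equal `ρ * (1 - blocking probability)`, so their order is reversed for blocking.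
    change erlMean _ _ ≤ meanNumber π k at hlow
    change meanNumber π k ≤ erlMean _ _ at hupp
    rw [meanNumber_eq_mul hmu h k, erlMean_eq_mul hρ] at hlow hupp
    have h1 := le_of_mul_le_mul_left hlow hρ
    have h2 := le_of_mul_le_mul_left hupp hρ
    exact ⟨by linarith, by linarith⟩
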